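/- For integers $s_1,\dots,s_k\ge 1$, let the generalized theta graph $\Theta_{s_1,\dots,s_k}$ be the graph obtained by joining two distinct vertices (the endvertices) by $k$ internally disjoint paths of lengths $s_1,\dots,s_k$. For a finite graph $G$ with at least one vertex, let $\pi(G,z)$ be its chromatic polynomial, i.e. the polynomial whose value at every $n\in\mathbb{N}$ is the number of proper $n$-colorings of $G$, and let $$\rho(G)=\max\{|z-1| : z\in\mathbb{C},\ \pi(G,z)=0\}.$$ Write $\rho(s_1,\dots,s_k)=\rho(\Theta_{s_1,\dots,s_k})$ and $\rho^{(2,k)}=\rho(2,\dots,2)$ ($k$ entries). **Theorem.** Let $3\le k\le 8$. The graph $\Theta_{2,\dots,2}$ (with $k$ paths) is isomorphic to the complete bipartite graph $K_{2,k}$, and for all integers $s_1,\dots,s_k\ge 1$ we have $$\rho(s_1,\dots,s_k)\le\rho^{(2,k)},$$ with equality if and only if $s_1=\dots=s_k=2$. In other words, among all $k$-ary generalized theta graphs, $K_{2,k}$ is the one with a chromatic root that maximizes $|z-1|$. -/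

import Mathlib

/-- The number of proper `n`-colourings of a finite graph is a polynomial function of `n`. -/
theorem exists_chromaticPolynomial {V : Type*} [Finite V] (G : SimpleGraph V) :
    ∃ P : Polynomial ℤ, ∀ n : ℕ, P.eval (n : ℤ) = (Nat.card (G.Coloring (Fin n)) : ℤ) := by
  classical
  have := Fintype.ofFinite V
  let E : Finset (V × V) := Finset.univ.filter fun p => G.Adj p.1 p.2
  let c : Finset (V × V) → ℕ := fun A => Nat.card (Quot fun a b : V => (a, b) ∈ A)
  refine ⟨∑ A ∈ E.powerset, (-1) ^ A.card * Polynomial.X ^ c A, fun n => ?_⟩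
  have hmono : ∀ A : Finset (V × V),
      (∑ f : V → Fin n, if ∀ p ∈ A, f p.1 = f p.2 then (1 : ℤ) else 0) = (n : ℤ) ^ c A := by
    intro A
    let e : {f : V → Fin n // ∀ p ∈ A, f p.1 = f p.2} ≃
        ((Quot fun a b : V => (a, b) ∈ A) → Fin n) :=
      { toFun := fun f => Quot.lift f.1 fun a b h => f.2 (a, b) h
        invFun := fun g => ⟨fun v => g (Quot.mk _ v), fun p hp => congrArg g (Quot.sound hp)⟩
        left_inv := fun f => rfl
        right_inv := fun g => by
          funext q
          induction q using Quot.ind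
          rfl }
    have h := Nat.card_congr e
    rw [Nat.card_fun, Nat.card_fin, Nat.card_eq_fintype_card, Fintype.card_subtype] at h
    rw [Finset.sum_boole, h]
    push_cast
    rfl
  have hcol : (Nat.card (G.Coloring (Fin n)) : ℤ) =
      ∑ f : V → Fin n, if ∀ p ∈ E, f p.1 ≠ f p.2 then (1 : ℤ) else 0 := by
    let e : G.Coloring (Fin n) ≃ {f : V → Fin n // ∀ p ∈ E, f p.1 ≠ f p.2} :=
      { toFun := fun C => ⟨C, fun p hp => C.valid (by simpa [E] using hp)⟩
        invFun := fun f => SimpleGraph.Coloring.mk f.1 fun {a b} h => f.2 (a, b) (by simpa [E] using h)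
        left_inv := fun C => rfl
        right_inv := fun f => rfl }
    rw [Finset.sum_boole, Nat.card_congr e, Nat.card_eq_fintype_card, Fintype.card_subtype]
  have hpt : ∀ f : V → Fin n, (if ∀ p ∈ E, f p.1 ≠ f p.2 then (1 : ℤ) else 0) =
      ∑ A ∈ E.powerset, (-1) ^ A.card * (if ∀ p ∈ A, f p.1 = f p.2 then (1 : ℤ) else 0) := by
    intro f
    have h1 : (if ∀ p ∈ E, f p.1 ≠ f p.2 then (1 : ℤ) else 0) =
        ∏ p ∈ E, (1 - if f p.1 = f p.2 then (1 : ℤ) else 0) := by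
      have h2 : ∀ p ∈ E, (1 - if f p.1 = f p.2 then (1 : ℤ) else 0) =
          if f p.1 ≠ f p.2 then 1 else 0 := by
        intro p _
        by_cases h : f p.1 = f p.2 <;> simp [h]
      rw [Finset.prod_congr rfl h2, Finset.prod_boole]
      congr
    rw [h1, Finset.prod_sub]
    refine Finset.sum_congr rfl fun A _ => ?_
    simp [Finset.prod_boole]
  rw [hcol, Finset.sum_congr rfl fun f _ => hpt f, Finset.sum_comm, Polynomial.eval_finsetSum]
  refine Finset.sum_congr rfl fun A _ => ?_
  rw [← Finset.mul_sum, hmono]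
  simp

/-- The chromatic polynomial `π(G, ·)`: the polynomial whose value at every natural number `n` is
the number of proper `n`-colourings of `G`. (It is unique: two polynomials that agree at all
natural numbers are equal.) -/
noncomputable def chromaticPolynomial {V : Type*} [Finite V] (G : SimpleGraph V) :
    Polynomial ℤ :=
  (exists_chromaticPolynomial G).choose

theorem chromaticPolynomial_eval {V : Type*} [Finite V] (G : SimpleGraph V) (n : ℕ) :
    (chromaticPolynomial G).eval (n : ℤ) = (Nat.card (G.Coloring (Fin n)) : ℤ) :=
  (exists_chromaticPolynomial G).choose_spec n

/-- `ρ(G) = max {|z - 1| : z ∈ ℂ, π(G, z) = 0}`. -/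
noncomputable def chromaticRadius {V : Type*} [Finite V] (G : SimpleGraph V) : ℝ :=
  sSup {x : ℝ | ∃ z : ℂ, Polynomial.aeval z (chromaticPolynomial G) = 0 ∧ x = ‖z - 1‖}

/-- For a finite graph with at least one vertex, the supremum in `chromaticRadius` is a maximum. -/
theorem chromaticRadius_isGreatest {V : Type*} [Finite V] [Nonempty V] (G : SimpleGraph V) :
    IsGreatest {x : ℝ | ∃ z : ℂ, Polynomial.aeval z (chromaticPolynomial G) = 0 ∧ x = ‖z - 1‖}
      (chromaticRadius G) := by
  have hne : chromaticPolynomial G ≠ 0 := by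
    intro h
    have h1 := chromaticPolynomial_eval G (Nat.card V)
    have : Nonempty (G.Coloring (Fin (Nat.card V))) :=
      ⟨SimpleGraph.Coloring.mk (Finite.equivFin V) fun {a b} hab heq =>
        hab.ne ((Finite.equivFin V).injective heq)⟩
    have : Finite (G.Coloring (Fin (Nat.card V))) := DFunLike.finite _
    have h2 : 0 < Nat.card (G.Coloring (Fin (Nat.card V))) := Nat.card_pos
    rw [h, Polynomial.eval_zero] at h1
    omega
  have h0 : Polynomial.aeval (0 : ℂ) (chromaticPolynomial G) = 0 := by
    have h1 := chromaticPolynomial_eval G 0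
    have : IsEmpty (G.Coloring (Fin 0)) :=
      ⟨fun C => (C (Classical.arbitrary V)).elim0⟩
    rw [Nat.card_of_isEmpty] at h1
    have h2 := Polynomial.aeval_algebraMap_apply_eq_algebraMap_eval (A := ℂ) (0 : ℤ)
      (chromaticPolynomial G)
    simp only [Nat.cast_zero] at h1
    rw [h1] at h2
    simpa using h2
  have hfin : {x : ℝ | ∃ z : ℂ,
      Polynomial.aeval z (chromaticPolynomial G) = 0 ∧ x = ‖z - 1‖}.Finite := by
    refine (((chromaticPolynomial G).rootSet_finite ℂ).image fun z => ‖z - 1‖).subset ?_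
    rintro x ⟨z, hz, rfl⟩
    exact ⟨z, (Polynomial.mem_rootSet_of_ne hne).2 hz, rfl⟩
  have hnon : {x : ℝ | ∃ z : ℂ,
      Polynomial.aeval z (chromaticPolynomial G) = 0 ∧ x = ‖z - 1‖}.Nonempty :=
    ⟨_, 0, h0, rfl⟩
  exact ⟨hnon.csSup_mem hfin, fun x hx => le_csSup hfin.bddAbove hx⟩

/-- The vertices of `Θ_{s₁,…,s_k}`: the two endvertices `Sum.inl false` and `Sum.inl true`, and
for each `i` the `s i - 1` internal vertices of the `i`-th path. -/
abbrev ThetaVertex {k : ℕ} (s : Fin k → ℕ) : Type :=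
  Bool ⊕ (Σ i : Fin k, Fin (s i - 1))

/-- The `j`-th vertex, `0 ≤ j ≤ s i`, on the `i`-th path: it is the first endvertex for `j = 0`,
the second endvertex for `j = s i`, and an internal vertex of the path in between. -/
def thetaPathVertex {k : ℕ} (s : Fin k → ℕ) (i : Fin k) (j : ℕ) : ThetaVertex s :=
  if h0 : j = 0 then Sum.inl false
  else if h : j < s i then Sum.inr ⟨i, ⟨j - 1, by omega⟩⟩
  else Sum.inl true

/-- The generalized theta graph `Θ_{s₁,…,s_k}` (for `s i ≥ 1`): two endvertices joined by `k`
internally disjoint paths of lengths `s₁, …, s_k`. Parallel edges, which arise when several of the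
`s i` are `1`, are drawn once; they do not affect proper colourings. -/
def thetaGraph {k : ℕ} (s : Fin k → ℕ) : SimpleGraph (ThetaVertex s) :=
  SimpleGraph.fromRel fun a b =>
    ∃ i : Fin k, ∃ j : ℕ, j < s i ∧ a = thetaPathVertex s i j ∧ b = thetaPathVertex s i (j + 1)

/-! Counting colourings path by path, and substituting `y = 1 / (1 - z)`, turns the chromatic roots
with `y ≠ 0, 1` into the solutions of `∏ (1 - y ^ s i) = y * ∏ (1 - y ^ (s i - 1))`. Large `‖z - 1‖`
means small `‖y‖`. For `K_{2,k}` the equation reduces to `(1 + y) ^ k = y`. It therefore suffices to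
find `R < 1` such that this reduced equation has a root in the disk `‖y‖ ≤ R`, while the equation of
every other theta graph has none there (`SeparatingRadius`). Then every other radius is `< R⁻¹`, and
that of `K_{2,k}` is `≥ R⁻¹`.

The root for `K_{2,k}` comes from a rational approximation and `exists_root_norm_sub_le`.
Zero-freeness for the other graphs with all lengths at least 2 comes mostly from
`prod_one_sub_mul_ne`, which reduces infinitely many length patterns to an inequality in `R` alone.
This settles `k ≤ 5`. For `k = 6, 7, 8` it leaves the patterns `(3,2,…,2)`, and also `(4,2,…,2)`
when `k = 8`; there an explicit approximate inverse (`ne_zero_of_mul_eq`) excludes zeros. A path of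
length 1 forces `‖y‖ = 1`, hence no zeros in the disk. -/

/-! ### Zero-freeness by the triangle inequality -/

/-- Factor out `1 - y` and bound the remaining geometric sum termwise. Keeping the factor `‖1 - y‖`
lets it cancel later against the constant term `1 - y`. -/
theorem norm_pow_sub_self_le {y : ℂ} {R : ℝ} (hR1 : R < 1) (hy : ‖y‖ ≤ R) (j : ℕ) :
    ‖y ^ (j + 1) - y‖ * (1 - R) ≤ ‖1 - y‖ * (R - R ^ (j + 1)) := by
  have h0 : 0 ≤ R := (norm_nonneg y).trans hy
  have h1 : y ^ (j + 1) - y = -((1 - y) * (y * ∑ i ∈ Finset.range j, y ^ i)) := by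
    have := mul_neg_geom_sum y j
    linear_combination y * this
  have h2 : R - R ^ (j + 1) = (1 - R) * (R * ∑ i ∈ Finset.range j, R ^ i) := by
    have := mul_neg_geom_sum R j
    linear_combination -R * this
  have h3 : ‖∑ i ∈ Finset.range j, y ^ i‖ ≤ ∑ i ∈ Finset.range j, R ^ i := by
    refine (norm_sum_le _ _).trans (Finset.sum_le_sum fun i _ => ?_)
    rw [norm_pow]
    gcongr
  rw [h1, h2, norm_neg, norm_mul, norm_mul]
  have h4 : ‖y‖ * ‖∑ i ∈ Finset.range j, y ^ i‖ ≤ R * ∑ i ∈ Finset.range j, R ^ i := by gcongr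
  have h5 : 0 ≤ ‖1 - y‖ * (1 - R) := mul_nonneg (norm_nonneg _) (by linarith)
  nlinarith [mul_le_mul_of_nonneg_left h4 h5]

/-- A product criterion, obtained from the triangle inequality after expanding both products. -/
theorem prod_one_sub_mul_ne {ι : Type*} [Fintype ι] {y : ℂ} {R : ℝ} (hR1 : R < 1) (hy : ‖y‖ ≤ R)
    (p : ι → ℂ) (ρ : ι → ℝ) (hp : ∀ i, ‖p i‖ ≤ ρ i)
    (h : R * ∏ i, (1 + ρ i) < ∏ i, (1 + R * ρ i)) :
    ∏ i, (1 - y * p i) ≠ y * ∏ i, (1 - p i) := by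
  classical
  intro heq
  have e1 : ∏ i, (1 - y * p i) - y * ∏ i, (1 - p i) =
      ∑ T : Finset ι, (y ^ T.card - y) * ∏ i ∈ T, (-p i) := by
    have a1 : ∏ i, (1 - y * p i) = ∑ T : Finset ι, y ^ T.card * ∏ i ∈ T, (-p i) := by
      have : ∀ i, 1 - y * p i = 1 + y * (-p i) := fun i => by ring
      simp_rw [this, Finset.prod_one_add, Finset.powerset_univ, Finset.prod_mul_distrib,
        Finset.prod_const]
    have a2 : ∏ i, (1 - p i) = ∑ T : Finset ι, ∏ i ∈ T, (-p i) := by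
      simp_rw [sub_eq_add_neg, Finset.prod_one_add, Finset.powerset_univ]
    rw [a1, a2, Finset.mul_sum, ← Finset.sum_sub_distrib]
    exact Finset.sum_congr rfl fun T _ => by ring
  have e2 : R * ∏ i, (1 + ρ i) - ∏ i, (1 + R * ρ i) =
      ∑ T : Finset ι, (R - R ^ T.card) * ∏ i ∈ T, ρ i := by
    simp_rw [Finset.prod_one_add, Finset.powerset_univ, Finset.prod_mul_distrib,
      Finset.prod_const]
    rw [Finset.mul_sum, ← Finset.sum_sub_distrib]
    exact Finset.sum_congr rfl fun T _ => by ring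
  -- The empty set contributes `1 - y` and `R - 1` respectively. Singletons contribute nothing,
  -- since `y ^ 1 - y = 0`.
  rw [← Finset.add_sum_erase _ _ (Finset.mem_univ (∅ : Finset ι))] at e1 e2
  simp only [Finset.card_empty, pow_zero, Finset.prod_empty, mul_one] at e1 e2
  have hb : ∀ T ∈ Finset.univ.erase (∅ : Finset ι),
      ‖(y ^ T.card - y) * ∏ i ∈ T, (-p i)‖ * (1 - R) ≤
        ‖1 - y‖ * ((R - R ^ T.card) * ∏ i ∈ T, ρ i) := by
    intro T hT
    have hT0 : T.card ≠ 0 := by simpa using hT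
    obtain ⟨j, hj⟩ := Nat.exists_eq_succ_of_ne_zero hT0
    rw [hj, norm_mul, norm_prod]
    have c1 := norm_pow_sub_self_le hR1 hy j
    have c2 : ∏ i ∈ T, ‖-p i‖ ≤ ∏ i ∈ T, ρ i :=
      Finset.prod_le_prod (fun _ _ => norm_nonneg _) fun i _ => by simpa using hp i
    have c3 : 0 ≤ ∏ i ∈ T, ‖-p i‖ := Finset.prod_nonneg fun _ _ => norm_nonneg _
    calc _ = (‖y ^ (j + 1) - y‖ * (1 - R)) * ∏ i ∈ T, ‖-p i‖ := by ring
      _ ≤ (‖1 - y‖ * (R - R ^ (j + 1))) * ∏ i ∈ T, ρ i := by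
        refine mul_le_mul c1 c2 c3 (le_trans ?_ c1)
        exact mul_nonneg (norm_nonneg _) (by linarith)
      _ = _ := by rw [Nat.succ_eq_add_one]; ring
  have hs : ‖∑ T ∈ Finset.univ.erase (∅ : Finset ι), (y ^ T.card - y) * ∏ i ∈ T, (-p i)‖ * (1 - R)
      ≤ ‖1 - y‖ * ∑ T ∈ Finset.univ.erase (∅ : Finset ι), (R - R ^ T.card) * ∏ i ∈ T, ρ i := by
    rw [Finset.mul_sum]
    refine le_trans ?_ (Finset.sum_le_sum hb)
    rw [← Finset.sum_mul]
    exact mul_le_mul_of_nonneg_right (norm_sum_le _ _) (by linarith)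
  have h1y : 0 < ‖1 - y‖ := by
    rw [norm_pos_iff, sub_ne_zero]
    rintro rfl
    simp at hy
    linarith
  rw [heq, sub_self] at e1
  have e3 : ∑ T ∈ Finset.univ.erase (∅ : Finset ι), (y ^ T.card - y) * ∏ i ∈ T, (-p i) =
      -(1 - y) := by linear_combination -e1
  rw [e3, norm_neg] at hs
  -- Cancelling `‖1 - y‖` leaves `1 - R` bounded by the sum over nonempty sets; by `e2` this
  -- contradicts `h`.
  nlinarith [mul_pos h1y (sub_pos.2 h)]

/-! ### Certificates for the presence and absence of roots -/

/-- A monic polynomial with a small value at `a` has a root near `a`. -/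
theorem exists_root_norm_sub_le {f : Polynomial ℂ} (hf : f.Monic) (hd : f.natDegree ≠ 0)
    {a : ℂ} {δ : ℝ} (hδ : 0 ≤ δ) (h : ‖f.eval a‖ ≤ δ ^ f.natDegree) :
    ∃ z : ℂ, f.IsRoot z ∧ ‖a - z‖ ≤ δ := by
  by_contra! hc
  have hs := IsAlgClosed.splits f
  have h1 := hs.eval_eq_prod_roots_of_monic hf a
  have hcard := hs.natDegree_eq_card_roots
  have h2 : ‖f.eval a‖ = (f.roots.map fun z => ‖a - z‖).prod := by
    rw [h1]
    have := map_multiset_prod (normHom : ℂ →*₀ ℝ) (f.roots.map fun z => a - z)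
    simpa [Multiset.map_map, Function.comp_def] using this
  have h3 : ∀ m : Multiset ℂ, (∀ z ∈ m, δ < ‖a - z‖) → m ≠ 0 →
      δ ^ m.card < (m.map fun z => ‖a - z‖).prod := by
    intro m
    induction m using Multiset.induction_on with
    | empty => simp
    | cons z m ih =>
      intro hm _
      have hz := hm z (Multiset.mem_cons_self _ _)
      rcases eq_or_ne m 0 with rfl | h0
      · simpa using hz
      · have := ih (fun w hw => hm w (Multiset.mem_cons_of_mem hw)) h0
        rw [Multiset.card_cons, pow_succ, Multiset.map_cons, Multiset.prod_cons, mul_comm]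
        exact mul_lt_mul'' hz this hδ (pow_nonneg hδ _)
  -- If all roots were farther than `δ` from `a`, the product of the distances, which is `‖f.eval
  -- a‖`, would exceed `δ ^ f.natDegree`.
  have h4 := h3 f.roots (fun z hz => hc z (Polynomial.isRoot_of_mem_roots hz)) (by
    intro h0
    rw [h0] at hcard
    exact hd (by simpa using hcard))
  rw [← h2, ← hcard] at h4
  linarith

theorem exists_one_add_pow_eq_self {k : ℕ} (hk : 2 ≤ k) {R δ : ℝ} (hδ : 0 ≤ δ) (a : ℂ)
    (ha : ‖a‖ + δ ≤ R) (h : ‖(1 + a) ^ k - a‖ ≤ δ ^ k) :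
    ∃ y : ℂ, (1 + y) ^ k = y ∧ ‖y‖ ≤ R := by
  have hm0 : ((1 + Polynomial.X : Polynomial ℂ) ^ k).Monic := by
    rw [add_comm]
    exact (Polynomial.monic_X_add_C (1 : ℂ)).pow k
  have hd0 : ((1 + Polynomial.X : Polynomial ℂ) ^ k).natDegree = k := by
    have := Polynomial.natDegree_pow_X_add_C (n := k) (1 : ℂ)
    rwa [add_comm, map_one] at this
  have hlt : (Polynomial.X : Polynomial ℂ).degree < ((1 + Polynomial.X : Polynomial ℂ) ^ k).degree := by
    rw [Polynomial.degree_X, Polynomial.degree_eq_natDegree hm0.ne_zero, hd0]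
    exact_mod_cast hk
  have hm : ((1 + Polynomial.X : Polynomial ℂ) ^ k - Polynomial.X).Monic := hm0.sub_of_left hlt
  have hd : ((1 + Polynomial.X : Polynomial ℂ) ^ k - Polynomial.X).natDegree = k := by
    rw [Polynomial.natDegree_sub_eq_left_of_natDegree_lt, hd0]
    rw [hd0, Polynomial.natDegree_X]
    omega
  obtain ⟨z, hz, hz'⟩ := exists_root_norm_sub_le hm (by omega) (a := a) hδ (by simpa [hd] using h)
  refine ⟨z, by simpa [Polynomial.IsRoot, sub_eq_zero] using hz, ?_⟩
  have := norm_sub_norm_le z a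
  rw [norm_sub_rev] at this
  linarith

theorem norm_foldr_le {y : ℂ} {R : ℝ} (hy : ‖y‖ ≤ R) (l : List ℤ) :
    ‖l.foldr (fun (c : ℤ) a => (c : ℂ) + y * a) 0‖ ≤ l.foldr (fun (c : ℤ) a => |(c : ℝ)| + R * a) 0 := by
  induction l with
  | nil => simp
  | cons c l ih =>
    have h0 : 0 ≤ R := (norm_nonneg y).trans hy
    simp only [List.foldr_cons]
    refine (norm_add_le _ _).trans ?_
    rw [norm_mul, Complex.norm_intCast]
    gcongr

/-- `g` does not vanish if some multiple of it is `1` plus a small polynomial. -/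
theorem ne_zero_of_mul_eq {y g M : ℂ} {R : ℝ} (hy : ‖y‖ ≤ R) (l : List ℤ)
    (h : g * M = 1 + l.foldr (fun (c : ℤ) a => (c : ℂ) + y * a) 0)
    (hl : l.foldr (fun (c : ℤ) a => |(c : ℝ)| + R * a) 0 < 1) : g ≠ 0 := by
  rintro rfl
  have h1 := (norm_foldr_le hy l).trans_lt hl
  have h2 : l.foldr (fun (c : ℤ) a => (c : ℂ) + y * a) 0 = -1 := by linear_combination -h
  rw [h2] at h1
  simp at h1

/-! ### The product criterion for theta graphs -/

/-- The product criterion with `p i = y ^ (s i - 1)`: its norm is at most `R` on every path, and at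
most `R ^ m` on the path `i₀`. -/
theorem prod_ne_of_le {n : ℕ} {s : Fin (n + 1) → ℕ} (hs : ∀ i, 2 ≤ s i) {i₀ : Fin (n + 1)} (m : ℕ)
    (hm : m + 1 ≤ s i₀) {y : ℂ} {R : ℝ} (hR1 : R < 1) (hy : ‖y‖ ≤ R)
    (h : R * ((1 + R ^ m) * (1 + R) ^ n) < (1 + R * R ^ m) * (1 + R * R) ^ n) :
    ∏ i, (1 - y ^ s i) ≠ y * ∏ i, (1 - y ^ (s i - 1)) := by
  have h0 : 0 ≤ R := (norm_nonneg y).trans hy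
  have e : ∀ i, y ^ s i = y * y ^ (s i - 1) := fun i => by
    rw [← pow_succ', Nat.sub_add_cancel (by have := hs i; omega)]
  simp_rw [e]
  have hc : (Finset.univ \ {i₀}).card = n := by
    rw [Finset.card_sdiff_of_subset (by simp)]; simp
  have hprod : ∀ f : ℝ → ℝ, ∏ i, f (Function.update (fun _ => R) i₀ (R ^ m) i) = f (R ^ m) * f R ^ n := by
    intro f
    have : ∀ i, f (Function.update (fun _ => R) i₀ (R ^ m) i) =
        Function.update (fun _ => f R) i₀ (f (R ^ m)) i := fun i => by
      by_cases hi : i = i₀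
      · subst hi; simp
      · simp [hi]
    simp_rw [this]
    rw [Finset.prod_update_of_mem (Finset.mem_univ _), Finset.prod_const, hc]
  refine prod_one_sub_mul_ne hR1 hy _ (Function.update (fun _ => R) i₀ (R ^ m)) (fun i => ?_) ?_
  · rw [norm_pow]
    have h1 : ‖y‖ ^ (s i - 1) ≤ R ^ (s i - 1) := by gcongr
    refine h1.trans ?_
    by_cases hi : i = i₀
    · subst hi
      simpa using pow_le_pow_of_le_one h0 hR1.le (by omega)
    · have := hs i
      simpa [hi] using pow_le_pow_of_le_one h0 hR1.le (show 1 ≤ s i - 1 by omega)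
  · rwa [hprod (fun x => 1 + x), hprod (fun x => 1 + R * x)]

theorem prod_ne_of_two {n : ℕ} {s : Fin (n + 2) → ℕ} (hs : ∀ i, 2 ≤ s i) {i₀ i₁ : Fin (n + 2)}
    (hne : i₁ ≠ i₀) (hm : 3 ≤ s i₀) (hm' : 3 ≤ s i₁) {y : ℂ} {R : ℝ} (hR1 : R < 1) (hy : ‖y‖ ≤ R)
    (h : R * ((1 + R ^ 2) ^ 2 * (1 + R) ^ n) < (1 + R * R ^ 2) ^ 2 * (1 + R * R) ^ n) :
    ∏ i, (1 - y ^ s i) ≠ y * ∏ i, (1 - y ^ (s i - 1)) := by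
  have h0 : 0 ≤ R := (norm_nonneg y).trans hy
  have e : ∀ i, y ^ s i = y * y ^ (s i - 1) := fun i => by
    rw [← pow_succ', Nat.sub_add_cancel (by have := hs i; omega)]
  simp_rw [e]
  have hc : (Finset.univ \ {i₀, i₁}).card = n := by
    rw [Finset.card_sdiff_of_subset (by simp), Finset.card_pair hne.symm]; simp
  have hprod : ∀ f : ℝ → ℝ, ∏ i, f (if i = i₀ ∨ i = i₁ then R ^ 2 else R) = f (R ^ 2) ^ 2 * f R ^ n := by
    intro f
    rw [← Finset.prod_sdiff (Finset.subset_univ {i₀, i₁}), mul_comm]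
    congr 1
    · rw [Finset.prod_pair hne.symm]; simp [sq]
    · rw [Finset.prod_congr rfl fun i hi => by rw [if_neg (by simpa using hi)], Finset.prod_const, hc]
  refine prod_one_sub_mul_ne hR1 hy _ (fun i => if i = i₀ ∨ i = i₁ then R ^ 2 else R)
    (fun i => ?_) ?_
  · rw [norm_pow]
    have h1 : ‖y‖ ^ (s i - 1) ≤ R ^ (s i - 1) := by gcongr
    refine h1.trans ?_
    split_ifs with hi
    · refine pow_le_pow_of_le_one h0 hR1.le ?_
      rcases hi with rfl | rfl <;> omega
    · have := hs i
      simpa using pow_le_pow_of_le_one h0 hR1.le (show 1 ≤ s i - 1 by omega)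
  · rwa [hprod (fun x => 1 + x), hprod (fun x => 1 + R * x)]

theorem prod_ne_of_eq {n : ℕ} {s : Fin (n + 1) → ℕ} {i₀ : Fin (n + 1)}
    (hi : ∀ i, i ≠ i₀ → s i = 2) {y : ℂ}
    (h : (1 - y ^ s i₀) * (1 - y ^ 2) ^ n ≠ y * ((1 - y ^ (s i₀ - 1)) * (1 - y) ^ n)) :
    ∏ i, (1 - y ^ s i) ≠ y * ∏ i, (1 - y ^ (s i - 1)) := by
  have hprod : ∀ f : ℕ → ℂ, ∏ i, f (s i) = f (s i₀) * f 2 ^ n := by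
    intro f
    rw [← Finset.mul_prod_erase _ _ (Finset.mem_univ i₀)]
    congr 1
    rw [Finset.prod_congr rfl fun i h => by rw [hi i (Finset.ne_of_mem_erase h)]]
    simp
  rw [hprod (fun t => 1 - y ^ t), hprod (fun t => 1 - y ^ (t - 1))]
  simpa using h

/-! ### Exceptional patterns with a single path longer than 2 -/

theorem reducedTheta_six_three_ne_zero {y : ℂ} (hy : ‖y‖ ≤ 37 / 100) :
    (1 + y) ^ 4 * (1 + y + y ^ 2) - y ≠ 0 := by
  -- `M` is the Taylor polynomial at 0 of the reciprocal of the left-hand side, so the product is `1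
  -- + O(y ^ 6)`. The list gives the coefficients of the error, constant term first. The next three
  -- proofs follow the same pattern with longer truncations.
  refine ne_zero_of_mul_eq (M := (1) * y ^ 0 + (-4) * y ^ 1 + (5) * y ^ 2 + (10) * y ^ 3 + (-50) * y ^ 4 + (59) * y ^ 5) hy
    [0, 0, 0, 0, 0, 0, -138, 80, 331, 409, 245, 59] ?_ ?_
  · simp only [List.foldr_cons, List.foldr_nil]
    push_cast
    ring
  · norm_num [List.foldr_cons, List.foldr_nil, abs_of_nonneg, abs_of_neg]

theorem reducedTheta_seven_three_ne_zero {y : ℂ} (hy : ‖y‖ ≤ 41 / 125) :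
    (1 + y) ^ 5 * (1 + y + y ^ 2) - y ≠ 0 := by
  refine ne_zero_of_mul_eq (M := (1) * y ^ 0 + (-5) * y ^ 1 + (9) * y ^ 2 + (10) * y ^ 3 + (-94) * y ^ 4 + (194) * y ^ 5 + (133) * y ^ 6 + (-1784) * y ^ 7 + (4083) * y ^ 8) hy
    [0, 0, 0, 0, 0, 0, 0, 0, 0, -1389, 26603, 60673, 74523, 54757, 22714, 4083] ?_ ?_
  · simp only [List.foldr_cons, List.foldr_nil]
    push_cast
    ring
  · norm_num [List.foldr_cons, List.foldr_nil, abs_of_nonneg, abs_of_neg]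

theorem reducedTheta_eight_three_ne_zero {y : ℂ} (hy : ‖y‖ ≤ 293 / 1000) :
    (1 + y) ^ 6 * (1 + y + y ^ 2) - y ≠ 0 := by
  refine ne_zero_of_mul_eq (M := (1) * y ^ 0 + (-6) * y ^ 1 + (14) * y ^ 2 + (7) * y ^ 3 + (-154) * y ^ 4 + (455) * y ^ 5 + (-105) * y ^ 6 + (-3865) * y ^ 7 + (13991) * y ^ 8 + (-11293) * y ^ 9) hy
    [0, 0, 0, 0, 0, 0, 0, 0, 0, 0, 91659, 136569, 78793, -76329, -182371, -154374, -65060, -11293] ?_ ?_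
  · simp only [List.foldr_cons, List.foldr_nil]
    push_cast
    ring
  · norm_num [List.foldr_cons, List.foldr_nil, abs_of_nonneg, abs_of_neg]

theorem reducedTheta_eight_four_ne_zero {y : ℂ} (hy : ‖y‖ ≤ 293 / 1000) :
    (1 + y) ^ 8 * (1 + y ^ 2) - y * (1 + y + y ^ 2) ≠ 0 := by
  refine ne_zero_of_mul_eq (M := (1) * y ^ 0 + (-7) * y ^ 1 + (21) * y ^ 2 + (-14) * y ^ 3 + (-147) * y ^ 4 + (672) * y ^ 5 + (-1078) * y ^ 6 + (-2367) * y ^ 7 + (18752) * y ^ 8 + (-46243) * y ^ 9 + (-7106) * y ^ 10 + (459669) * y ^ 11 + (-1611008) * y ^ 12 + (1568252) * y ^ 13) hy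
    [0, 0, 0, 0, 0, 0, 0, 0, 0, 0, 0, 0, 0, 0, -9386742, -16739039, -10728126, 16655180, 46626990, 63811494, 57319142, 33050913, 10935008, 1568252] ?_ ?_
  · simp only [List.foldr_cons, List.foldr_nil]
    push_cast
    ring
  · norm_num [List.foldr_cons, List.foldr_nil, abs_of_nonneg, abs_of_neg]

/-! ### Small roots of the equation for `K_{2,k}` -/

/-- A square-root-free form of the approximation criterion: `c` bounds the modulus of `a + bi`, and
the slack `R - c` is the permitted distance to a true root. -/
theorem exists_one_add_pow_eq_self_of_approx {k : ℕ} (hk : 2 ≤ k) {R : ℝ} (a b c : ℝ) (hc : 0 ≤ c)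
    (hcR : c ≤ R) (hab : a ^ 2 + b ^ 2 ≤ c ^ 2)
    (h : Complex.normSq ((1 + ⟨a, b⟩) ^ k - ⟨a, b⟩) ≤ ((R - c) ^ k) ^ 2) :
    ∃ y : ℂ, (1 + y) ^ k = y ∧ ‖y‖ ≤ R := by
  refine exists_one_add_pow_eq_self hk (sub_nonneg.2 hcR) ⟨a, b⟩ ?_ ?_
  · have : ‖(⟨a, b⟩ : ℂ)‖ ≤ c := by
      refine abs_le_of_sq_le_sq' ?_ hc |>.2
      rw [← Complex.normSq_eq_norm_sq, Complex.normSq_mk]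
      linarith
    linarith
  · refine abs_le_of_sq_le_sq' ?_ (pow_nonneg (sub_nonneg.2 hcR) _) |>.2
    rwa [← Complex.normSq_eq_norm_sq]

/-- Here and below, `a + bi` is a numerical root and `c` a rational upper bound for its modulus. The
residual must be at most `(R - c) ^ k`, so more digits are needed as `k` grows. -/
theorem exists_one_add_pow_three_eq_self : ∃ y : ℂ, (1 + y) ^ 3 = y ∧ ‖y‖ ≤ 17 / 25 := by
  refine exists_one_add_pow_eq_self_of_approx (by norm_num)
    (-8441 / 25000)
    (14057 / 25000)
    (327933 / 500000) ?_ ?_ ?_ ?_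
  · norm_num
  · norm_num
  · norm_num
  · norm_num [pow_succ, Complex.normSq_apply]

theorem exists_one_add_pow_four_eq_self : ∃ y : ℂ, (1 + y) ^ 4 = y ∧ ‖y‖ ≤ 13 / 25 := by
  refine exists_one_add_pow_eq_self_of_approx (by norm_num)
    (-3410799 / 12500000)
    (43001429 / 100000000)
    (509281 / 1000000) ?_ ?_ ?_ ?_
  · norm_num
  · norm_num
  · norm_num
  · norm_num [pow_succ, Complex.normSq_apply]

theorem exists_one_add_pow_five_eq_self : ∃ y : ℂ, (1 + y) ^ 5 = y ∧ ‖y‖ ≤ 429 / 1000 := by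
  refine exists_one_add_pow_eq_self_of_approx (by norm_num)
    (-235115566399 / 1000000000000)
    (22029471627 / 62500000000)
    (423693 / 1000000) ?_ ?_ ?_ ?_
  · norm_num
  · norm_num
  · norm_num
  · norm_num [pow_succ, Complex.normSq_apply]

theorem exists_one_add_pow_six_eq_self : ∃ y : ℂ, (1 + y) ^ 6 = y ∧ ‖y‖ ≤ 37 / 100 := by
  refine exists_one_add_pow_eq_self_of_approx (by norm_num)
    (-104666405592791 / 500000000000000)
    (18781682519347 / 62500000000000)
    (366231 / 1000000) ?_ ?_ ?_ ?_
  · norm_num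
  · norm_num
  · norm_num
  · norm_num [pow_succ, Complex.normSq_apply]

theorem exists_one_add_pow_seven_eq_self : ∃ y : ℂ, (1 + y) ^ 7 = y ∧ ‖y‖ ≤ 41 / 125 := by
  refine exists_one_add_pow_eq_self_of_approx (by norm_num)
    (-95071099702930579 / 500000000000000000)
    (262869645851243007 / 1000000000000000000)
    (32443 / 100000) ?_ ?_ ?_ ?_
  · norm_num
  · norm_num
  · norm_num
  · norm_num [pow_succ, Complex.normSq_apply]

theorem exists_one_add_pow_eight_eq_self : ∃ y : ℂ, (1 + y) ^ 8 = y ∧ ‖y‖ ≤ 293 / 1000 := by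
  refine exists_one_add_pow_eq_self_of_approx (by norm_num)
    (-700296070334522423206409 / 4000000000000000000000000)
    (23417442193136076783908559 / 100000000000000000000000000)
    (58477 / 200000) ?_ ?_ ?_ ?_
  · norm_num
  · norm_num
  · norm_num
  · norm_num [pow_succ, Complex.normSq_apply]

/-! ### Separating radii for `3 ≤ k ≤ 8` -/

/-- The circle of radius `R` separates the zeros of the reduced equation for `K_{2,k}` from those
for all other generalized theta graphs with `k` paths. -/
def SeparatingRadius (k : ℕ) (R : ℝ) : Prop :=
  0 < R ∧ R < 1 ∧ (∃ y : ℂ, (1 + y) ^ k = y ∧ ‖y‖ ≤ R) ∧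
    ∀ s : Fin k → ℕ, (∀ i, 2 ≤ s i) → (∃ i, s i ≠ 2) → ∀ y : ℂ, ‖y‖ ≤ R →
      ∏ i, (1 - y ^ s i) ≠ y * ∏ i, (1 - y ^ (s i - 1))

theorem separatingRadius_of_le {n : ℕ} {R : ℝ} (hR0 : 0 < R) (hR1 : R < 1)
    (hroot : ∃ y : ℂ, (1 + y) ^ (n + 1) = y ∧ ‖y‖ ≤ R)
    (h : R * ((1 + R ^ 2) * (1 + R) ^ n) < (1 + R * R ^ 2) * (1 + R * R) ^ n) :
    SeparatingRadius (n + 1) R := by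
  refine ⟨hR0, hR1, hroot, fun s hs ⟨i₀, hi₀⟩ y hy => ?_⟩
  have := hs i₀
  exact prod_ne_of_le hs (i₀ := i₀) 2 (by omega) hR1 hy h

/-- Either two paths are longer than 2, or exactly one is. A single long path falls to the product
criterion once its length exceeds `m`, leaving finitely many lengths to check by hand. -/
theorem separatingRadius_of_lt {n m : ℕ} {R : ℝ} (hR0 : 0 < R) (hR1 : R < 1)
    (hroot : ∃ y : ℂ, (1 + y) ^ (n + 2) = y ∧ ‖y‖ ≤ R)
    (h₂ : R * ((1 + R ^ 2) ^ 2 * (1 + R) ^ n) < (1 + R * R ^ 2) ^ 2 * (1 + R * R) ^ n)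
    (h₁ : R * ((1 + R ^ m) * (1 + R) ^ (n + 1)) < (1 + R * R ^ m) * (1 + R * R) ^ (n + 1))
    (h : ∀ t, 3 ≤ t → t ≤ m → ∀ y : ℂ, ‖y‖ ≤ R →
      (1 - y ^ t) * (1 - y ^ 2) ^ (n + 1) ≠ y * ((1 - y ^ (t - 1)) * (1 - y) ^ (n + 1))) :
    SeparatingRadius (n + 2) R := by
  refine ⟨hR0, hR1, hroot, fun s hs ⟨i₀, hi₀⟩ y hy => ?_⟩
  have h3 := hs i₀
  by_cases h1 : ∃ i₁, i₁ ≠ i₀ ∧ s i₁ ≠ 2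
  · obtain ⟨i₁, hne, h4⟩ := h1
    have h5 := hs i₁
    exact prod_ne_of_two hs hne (by omega) (by omega) hR1 hy h₂
  · push Not at h1
    by_cases h6 : m + 1 ≤ s i₀
    · exact prod_ne_of_le hs m h6 hR1 hy h₁
    · exact prod_ne_of_eq h1 (h (s i₀) (by omega) (by omega) y hy)

theorem one_sub_ne_zero_of_norm_le {y : ℂ} {R : ℝ} (hR : R < 1) (hy : ‖y‖ ≤ R) : 1 - y ≠ 0 := by
  rw [sub_ne_zero]
  rintro rfl
  simp at hy
  linarith

theorem three_two_pow_ne {n : ℕ} {y : ℂ} {R : ℝ} (hR : R < 1) (hy : ‖y‖ ≤ R)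
    (h : (1 + y) ^ n * (1 + y + y ^ 2) - y ≠ 0) :
    (1 - y ^ 3) * (1 - y ^ 2) ^ (n + 1) ≠ y * ((1 - y ^ (3 - 1)) * (1 - y) ^ (n + 1)) := by
  have h1 := one_sub_ne_zero_of_norm_le hR hy
  have h2 := one_sub_ne_zero_of_norm_le hR (y := -y) (by simpa using hy)
  rw [← sub_ne_zero]
  have e : (1 - y ^ 3) * (1 - y ^ 2) ^ (n + 1) - y * ((1 - y ^ (3 - 1)) * (1 - y) ^ (n + 1)) =
      (1 - y) ^ (n + 2) * (1 - -y) * ((1 + y) ^ n * (1 + y + y ^ 2) - y) := by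
    have : (1 - y ^ 2) ^ (n + 1) = (1 - y) ^ (n + 1) * (1 + y) ^ (n + 1) := by
      rw [← mul_pow]; ring
    rw [this]
    ring
  rw [e]
  exact mul_ne_zero (mul_ne_zero (pow_ne_zero _ h1) h2) h

theorem four_two_pow_ne {y : ℂ} {R : ℝ} (hR : R < 1) (hy : ‖y‖ ≤ R)
    (h : (1 + y) ^ 8 * (1 + y ^ 2) - y * (1 + y + y ^ 2) ≠ 0) :
    (1 - y ^ 4) * (1 - y ^ 2) ^ 7 ≠ y * ((1 - y ^ (4 - 1)) * (1 - y) ^ 7) := by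
  have h1 := one_sub_ne_zero_of_norm_le hR hy
  rw [← sub_ne_zero]
  have e : (1 - y ^ 4) * (1 - y ^ 2) ^ 7 - y * ((1 - y ^ (4 - 1)) * (1 - y) ^ 7) =
      (1 - y) ^ 8 * ((1 + y) ^ 8 * (1 + y ^ 2) - y * (1 + y + y ^ 2)) := by
    ring
  rw [e]
  exact mul_ne_zero (pow_ne_zero _ h1) h

theorem exists_separatingRadius {k : ℕ} (hk3 : 3 ≤ k) (hk8 : k ≤ 8) :
    ∃ R, SeparatingRadius k R := by
  interval_cases k
  -- In each case the radius is read off from the root lemma by unification.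
  · exact ⟨_, separatingRadius_of_le (by norm_num) (by norm_num)
      exists_one_add_pow_three_eq_self (by norm_num)⟩
  · exact ⟨_, separatingRadius_of_le (by norm_num) (by norm_num)
      exists_one_add_pow_four_eq_self (by norm_num)⟩
  · exact ⟨_, separatingRadius_of_le (by norm_num) (by norm_num)
      exists_one_add_pow_five_eq_self (by norm_num)⟩
  · refine ⟨_, separatingRadius_of_lt (m := 3) (by norm_num) (by norm_num)
      exists_one_add_pow_six_eq_self (by norm_num) (by norm_num) fun t ht ht' y hy => ?_⟩
    obtain rfl : t = 3 := by omega
    exact three_two_pow_ne (by norm_num) hy (reducedTheta_six_three_ne_zero hy)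
  · refine ⟨_, separatingRadius_of_lt (m := 3) (by norm_num) (by norm_num)
      exists_one_add_pow_seven_eq_self (by norm_num) (by norm_num) fun t ht ht' y hy => ?_⟩
    obtain rfl : t = 3 := by omega
    exact three_two_pow_ne (by norm_num) hy (reducedTheta_seven_three_ne_zero hy)
  -- With `m := 3` the numerical inequality fails at this radius, so length 4 also needs its own
  -- certificate.
  · refine ⟨_, separatingRadius_of_lt (m := 4) (by norm_num) (by norm_num)
      exists_one_add_pow_eight_eq_self (by norm_num) (by norm_num) fun t ht ht' y hy => ?_⟩
    obtain rfl | rfl : t = 3 ∨ t = 4 := by omega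
    · exact three_two_pow_ne (by norm_num) hy (reducedTheta_eight_three_ne_zero hy)
    · exact four_two_pow_ne (by norm_num) hy (reducedTheta_eight_four_ne_zero hy)

/-! ### Counting colourings of paths and theta graphs -/

/-- The colour of the `j`-th vertex of a path of length `s` whose endvertices are coloured `a`, `b`
and whose internal vertices are coloured by `f`. -/
def pathColor {α : Type*} (s : ℕ) (a b : α) (f : Fin (s - 1) → α) (j : ℕ) : α :=
  if h0 : j = 0 then a
  else if h : j < s then f ⟨j - 1, by omega⟩
  else b

/-- The proper colourings of the interior of a path of length `s` with endvertices coloured `a` and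
`b`. -/
abbrev PathColoring (α : Type*) (s : ℕ) (a b : α) : Type _ :=
  {f : Fin (s - 1) → α // ∀ j < s, pathColor s a b f j ≠ pathColor s a b f (j + 1)}

theorem pathColor_cons {α : Type*} {m : ℕ} (a b c : α) (f : Fin m → α) (j : ℕ) :
    pathColor (m + 2) a b (Fin.cons c f : Fin (m + 1) → α) (j + 1) = pathColor (m + 1) c b f j := by
  rcases j with _ | j
  · simp [pathColor]
  · simp only [pathColor, Nat.add_eq_zero_iff, one_ne_zero, and_false, dite_false,
      Nat.add_lt_add_iff_right, Nat.add_sub_cancel]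
    split_ifs with h
    · exact Fin.cons_succ (α := fun _ => α) c f ⟨j, by omega⟩
    · rfl

/-- Splitting off the first internal vertex of a path. -/
def pathColoringSuccEquiv (α : Type*) (m : ℕ) (a b : α) :
    PathColoring α (m + 2) a b ≃ Σ c : {c : α // a ≠ c}, PathColoring α (m + 1) c.1 b where
  toFun f := ⟨⟨f.1 (0 : Fin (m + 1)), by simpa [pathColor] using f.2 0 (by omega)⟩, Fin.tail (n := m) f.1, by
    intro j hj
    have := f.2 (j + 1) (by omega)
    rw [← Fin.cons_self_tail (n := m) f.1] at this
    simpa only [pathColor_cons] using this⟩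
  invFun p := ⟨Fin.cons (n := m) p.1.1 p.2.1, by
    rintro (_ | j) hj
    · rw [pathColor_cons]
      simpa [pathColor] using p.1.2
    · simpa only [pathColor_cons] using p.2.2 j (by omega)⟩
  left_inv f := Subtype.ext (Fin.cons_self_tail (n := m) f.1)
  right_inv p := rfl

/-- Induction on the length: sum the formula over the colours `c ≠ a` of the first internal vertex.
The factor `n` avoids division in `ℤ`. -/
theorem card_pathColoring (n m : ℕ) (a b : Fin n) :
    (n : ℤ) * Nat.card (PathColoring (Fin n) (m + 1) a b) =
      ((n : ℤ) - 1) ^ (m + 1) - (-1) ^ (m + 1) + if a = b then (-1) ^ (m + 1) * (n : ℤ) else 0 := by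
  classical
  induction m generalizing a with
  | zero =>
    by_cases h : a = b
    · have : IsEmpty (PathColoring (Fin n) (0 + 1) a b) :=
        ⟨fun f => f.2 0 (by omega) (by simp [pathColor, h])⟩
      rw [Nat.card_of_isEmpty]
      simp [h]
    · have : Unique (PathColoring (Fin n) (0 + 1) a b) :=
        { default := ⟨fun i => i.elim0, fun j hj => by
            obtain rfl : j = 0 := by omega
            simpa [pathColor] using h⟩
          uniq := fun f => Subtype.ext (funext fun i => i.elim0) }
      simp [h]
  | succ m ih =>
    rw [Nat.card_congr (pathColoringSuccEquiv (Fin n) m a b), Nat.card_sigma]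
    push_cast
    rw [Finset.mul_sum, Finset.sum_congr rfl fun c _ => ih c.1,
      ← Finset.sum_subtype (Finset.univ.erase a) (by simp [eq_comm]) fun c => (n - 1 : ℤ) ^ (m + 1) -
        (-1) ^ (m + 1) + if c = b then (-1) ^ (m + 1) * (n : ℤ) else 0,
      Finset.sum_erase_eq_sub (Finset.mem_univ a), Finset.sum_add_distrib]
    simp only [Finset.sum_const, Finset.card_univ, Fintype.card_fin, nsmul_eq_mul,
      Finset.sum_ite_eq', Finset.mem_univ, if_true]
    split_ifs <;> ring

theorem thetaPathVertex_ne {k : ℕ} (s : Fin k → ℕ) (i : Fin k) {j : ℕ} (hj : j < s i) :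
    thetaPathVertex s i j ≠ thetaPathVertex s i (j + 1) := by
  rcases j with _ | j
  · simp only [thetaPathVertex]
    split_ifs <;> simp_all
  · simp only [thetaPathVertex]
    split_ifs <;> simp_all

theorem thetaGraph_adj {k : ℕ} {s : Fin k → ℕ} {a b : ThetaVertex s} :
    (thetaGraph s).Adj a b ↔ ∃ i : Fin k, ∃ j < s i,
      (a = thetaPathVertex s i j ∧ b = thetaPathVertex s i (j + 1)) ∨
      (b = thetaPathVertex s i j ∧ a = thetaPathVertex s i (j + 1)) := by
  rw [thetaGraph, SimpleGraph.fromRel_adj]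
  constructor
  · rintro ⟨-, ⟨i, j, hj, h⟩ | ⟨i, j, hj, h⟩⟩
    · exact ⟨i, j, hj, Or.inl h⟩
    · exact ⟨i, j, hj, Or.inr h⟩
  · rintro ⟨i, j, hj, ⟨rfl, rfl⟩ | ⟨rfl, rfl⟩⟩
    · exact ⟨thetaPathVertex_ne s i hj, Or.inl ⟨i, j, hj, rfl, rfl⟩⟩
    · exact ⟨(thetaPathVertex_ne s i hj).symm, Or.inr ⟨i, j, hj, rfl, rfl⟩⟩

theorem sumElim_thetaPathVertex {α : Type*} {k : ℕ} (s : Fin k → ℕ) (e : Bool → α)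
    (f : ∀ i, Fin (s i - 1) → α) (i : Fin k) (j : ℕ) :
    Sum.elim e (fun p : Σ i, Fin (s i - 1) => f p.1 p.2) (thetaPathVertex s i j) =
      pathColor (s i) (e false) (e true) (f i) j := by
  simp only [thetaPathVertex, pathColor]
  split_ifs <;> rfl

/-- A proper colouring of a theta graph consists of colours for the endvertices and proper
colourings of the interiors of the paths. -/
def thetaColoringEquiv (α : Type*) {k : ℕ} (s : Fin k → ℕ) :
    (thetaGraph s).Coloring α ≃ Σ e : α × α, ∀ i, PathColoring α (s i) e.1 e.2 where
  toFun C := ⟨(C (Sum.inl false), C (Sum.inl true)), fun i => ⟨fun j => C (Sum.inr ⟨i, j⟩),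
    fun j hj => by
      have h := C.valid (thetaGraph_adj.2 ⟨i, j, hj, Or.inl ⟨rfl, rfl⟩⟩)
      have e : ∀ j, C (thetaPathVertex s i j) = pathColor (s i) (C (Sum.inl false))
          (C (Sum.inl true)) (fun j => C (Sum.inr ⟨i, j⟩)) j := fun j => by
        simp only [thetaPathVertex, pathColor]
        split_ifs <;> rfl
      rwa [e, e] at h⟩⟩
  invFun p := SimpleGraph.Coloring.mk
    (Sum.elim (fun x => cond x p.1.2 p.1.1) fun q : Σ i, Fin (s i - 1) => (p.2 q.1).1 q.2) (by
      intro a b hab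
      obtain ⟨i, j, hj, ⟨rfl, rfl⟩ | ⟨rfl, rfl⟩⟩ := thetaGraph_adj.1 hab
      · have h := (p.2 i).2 j hj
        rw [sumElim_thetaPathVertex s _ fun i => (p.2 i).1,
          sumElim_thetaPathVertex s _ fun i => (p.2 i).1]
        exact h
      · have h := (p.2 i).2 j hj
        rw [sumElim_thetaPathVertex s _ fun i => (p.2 i).1,
          sumElim_thetaPathVertex s _ fun i => (p.2 i).1]
        exact h.symm)
  left_inv C := by
    refine DFunLike.ext _ _ fun v => ?_
    rcases v with (_ | _) | v <;> rfl
  right_inv p := rfl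

/-- Once the end colours are fixed, the paths are coloured independently. The two products
correspond to equal and to distinct end colours. -/
theorem card_thetaGraph_coloring (n : ℕ) {k : ℕ} {s : Fin k → ℕ} (hs : ∀ i, 1 ≤ s i) :
    (n : ℤ) ^ k * Nat.card ((thetaGraph s).Coloring (Fin n)) =
      n * (∏ i, (((n : ℤ) - 1) ^ s i + (-1) ^ s i * (n - 1)) +
        (n - 1) * ∏ i, (((n : ℤ) - 1) ^ s i - (-1) ^ s i)) := by
  classical
  have hc : ∀ i (a b : Fin n), (n : ℤ) * Nat.card (PathColoring (Fin n) (s i) a b) =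
      if a = b then ((n : ℤ) - 1) ^ s i + (-1) ^ s i * (n - 1)
      else ((n : ℤ) - 1) ^ s i - (-1) ^ s i := by
    intro i a b
    obtain ⟨m, hm⟩ := Nat.exists_eq_add_of_le' (hs i)
    rw [hm, card_pathColoring]
    split_ifs <;> ring
  rw [Nat.card_congr (thetaColoringEquiv (Fin n) s), Nat.card_sigma]
  simp only [Nat.card_pi]
  push_cast
  have hp : ∀ a b : Fin n, (n : ℤ) ^ k * ∏ i, (Nat.card (PathColoring (Fin n) (s i) a b) : ℤ) =
      if a = b then ∏ i, (((n : ℤ) - 1) ^ s i + (-1) ^ s i * (n - 1))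
      else ∏ i, (((n : ℤ) - 1) ^ s i - (-1) ^ s i) := by
    intro a b
    have : (n : ℤ) ^ k = ∏ _i : Fin k, (n : ℤ) := by simp
    rw [this, ← Finset.prod_mul_distrib, Finset.prod_congr rfl fun i _ => hc i a b]
    split_ifs <;> rfl
  rw [Finset.mul_sum, Finset.sum_congr rfl fun p _ => hp p.1 p.2, Fintype.sum_prod_type]
  have hr : ∀ (a : Fin n) (A B : ℤ), ∑ b : Fin n, (if a = b then A else B) = A + (n - 1) * B := by
    intro a A B
    have : ∀ b : Fin n, (if a = b then A else B) = B + if a = b then A - B else 0 := fun b => by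
      split_ifs <;> ring
    rw [Finset.sum_congr rfl fun b _ => this b, Finset.sum_add_distrib]
    simp
    ring
  rw [Finset.sum_congr rfl fun a _ => hr a _ _]
  simp

/-! ### The chromatic root equation and the case `K_{2,k}` -/

open Polynomial in
theorem X_pow_mul_chromaticPolynomial_thetaGraph {k : ℕ} {s : Fin k → ℕ} (hs : ∀ i, 1 ≤ s i) :
    (X : ℤ[X]) ^ k * chromaticPolynomial (thetaGraph s) =
      X * (∏ i, ((X - 1) ^ s i + (-1) ^ s i * (X - 1)) + (X - 1) * ∏ i, ((X - 1) ^ s i - (-1) ^ s i)) := by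
  refine Polynomial.eq_of_infinite_eval_eq _ _
    (Set.Infinite.mono ?_ (Set.infinite_range_of_injective (Nat.cast_injective (R := ℤ))))
  rintro _ ⟨n, rfl⟩
  have := card_thetaGraph_coloring n hs
  simpa [eval_prod, chromaticPolynomial_eval] using this

/-- The nonzero chromatic roots of a generalized theta graph, in the variable `x = 1 - z`. -/
theorem aeval_chromaticPolynomial_thetaGraph_eq_zero_iff {k : ℕ} {s : Fin k → ℕ}
    (hs : ∀ i, 1 ≤ s i) {x : ℂ} (hx : x ≠ 1) :
    Polynomial.aeval (1 - x) (chromaticPolynomial (thetaGraph s)) = 0 ↔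
      ∏ i, (x ^ s i - x) = x * ∏ i, (x ^ s i - 1) := by
  have h0 : 1 - x ≠ 0 := sub_ne_zero.2 hx.symm
  have h := congrArg (Polynomial.aeval (1 - x)) (X_pow_mul_chromaticPolynomial_thetaGraph hs)
  simp only [map_mul, map_pow, map_add, map_sub, map_prod, map_one, map_neg,
    Polynomial.aeval_X] at h
  have e1 : ∀ t : ℕ, (1 - x - 1) ^ t + (-1) ^ t * (1 - x - 1) = (-1) ^ t * (x ^ t - x) := by
    intro t
    rw [show 1 - x - 1 = -1 * x by ring, mul_pow]
    ring
  have e2 : ∀ t : ℕ, (1 - x - 1) ^ t - (-1) ^ t = (-1) ^ t * (x ^ t - 1) := by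
    intro t
    rw [show 1 - x - 1 = -1 * x by ring, mul_pow]
    ring
  simp only [e1, e2, Finset.prod_mul_distrib] at h
  have h1 : (1 - x) ^ k * Polynomial.aeval (1 - x) (chromaticPolynomial (thetaGraph s)) =
      ((1 - x) * ∏ i, (-1) ^ s i) * (∏ i, (x ^ s i - x) - x * ∏ i, (x ^ s i - 1)) := by
    rw [h]; ring
  have h2 : (1 - x) * ∏ i, (-1 : ℂ) ^ s i ≠ 0 :=
    mul_ne_zero h0 (Finset.prod_ne_zero_iff.2 fun i _ => pow_ne_zero _ (by norm_num))
  rw [← mul_eq_zero_iff_left (pow_ne_zero k h0), h1, mul_eq_zero_iff_left h2, sub_eq_zero]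

/-- The complete bipartite graph `K_{2,k}` is the theta graph with `k` paths of length two. -/
theorem nonempty_thetaGraph_two_iso (k : ℕ) :
    Nonempty (thetaGraph (fun _ : Fin k => 2) ≃g completeBipartiteGraph (Fin 2) (Fin k)) := by
  let e : ThetaVertex (fun _ : Fin k => 2) ≃ Fin 2 ⊕ Fin k :=
    Equiv.sumCongr finTwoEquiv.symm
      { toFun := fun p => p.1
        invFun := fun i => ⟨i, (0 : Fin 1)⟩
        left_inv := fun ⟨i, j⟩ => by
          have : j = (0 : Fin 1) := Subsingleton.elim (α := Fin 1) _ _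
          rw [this]
        right_inv := fun i => rfl }
  have h0 : ∀ i, thetaPathVertex (fun _ : Fin k => 2) i 0 = Sum.inl false := fun i => rfl
  have h1 : ∀ i, thetaPathVertex (fun _ : Fin k => 2) i 1 = Sum.inr ⟨i, (0 : Fin 1)⟩ := fun i => rfl
  have h2 : ∀ i, thetaPathVertex (fun _ : Fin k => 2) i 2 = Sum.inl true := fun i => rfl
  have key : ∀ a b, (thetaGraph (fun _ : Fin k => 2)).Adj a b ↔
      (completeBipartiteGraph (Fin 2) (Fin k)).Adj (e a) (e b) := by
    intro a b
    constructor
    · intro h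
      obtain ⟨i, j, hj, h⟩ := thetaGraph_adj.1 h
      have : j = 0 ∨ j = 1 := by omega
      rcases this with rfl | rfl
      · rw [h0, h1] at h
        rcases h with ⟨rfl, rfl⟩ | ⟨rfl, rfl⟩ <;> simp [e]
      · rw [h1, h2] at h
        rcases h with ⟨rfl, rfl⟩ | ⟨rfl, rfl⟩ <;> simp [e]
    · intro h
      have hmid : ∀ (x : Bool) (i : Fin k) (j : Fin 1),
          (thetaGraph (fun _ : Fin k => 2)).Adj (Sum.inl x) (Sum.inr ⟨i, j⟩) := by
        intro x i j
        obtain rfl : j = 0 := Subsingleton.elim _ _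
        cases x
        · exact thetaGraph_adj.2 ⟨i, 0, by norm_num, Or.inl ⟨rfl, rfl⟩⟩
        · exact thetaGraph_adj.2 ⟨i, 1, by norm_num, Or.inr ⟨rfl, rfl⟩⟩
      rcases a with x | ⟨i, j⟩ <;> rcases b with x' | ⟨i', j'⟩
      · simp [e] at h
      · exact hmid x i' j'
      · exact (hmid x' i j).symm
      · simp [e] at h
  exact ⟨⟨e, fun {a b} => (key a b).symm⟩⟩

/-- The nonzero chromatic roots of a generalized theta graph, in the variable `y = 1 / (1 - z)`. -/
theorem aeval_chromaticPolynomial_thetaGraph_inv_eq_zero_iff {k : ℕ} {s : Fin k → ℕ}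
    (hs : ∀ i, 1 ≤ s i) {y : ℂ} (hy0 : y ≠ 0) (hy1 : y ≠ 1) :
    Polynomial.aeval (1 - y⁻¹) (chromaticPolynomial (thetaGraph s)) = 0 ↔
      ∏ i, (1 - y ^ s i) = y * ∏ i, (1 - y ^ (s i - 1)) := by
  rw [aeval_chromaticPolynomial_thetaGraph_eq_zero_iff hs (by simpa using hy1)]
  have e1 : ∀ i, y⁻¹ ^ s i - y⁻¹ = y⁻¹ ^ s i * (1 - y ^ (s i - 1)) := by
    intro i
    obtain ⟨m, hm⟩ := Nat.exists_eq_add_of_le' (hs i)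
    rw [hm, Nat.add_sub_cancel, mul_one_sub, pow_succ, mul_right_comm, ← mul_pow,
      inv_mul_cancel₀ hy0, one_pow, one_mul]
  have e2 : ∀ i, y⁻¹ ^ s i - 1 = y⁻¹ ^ s i * (1 - y ^ s i) := by
    intro i
    rw [mul_one_sub, ← mul_pow, inv_mul_cancel₀ hy0, one_pow]
  simp only [e1, e2, Finset.prod_mul_distrib]
  have h : ∏ i, y⁻¹ ^ s i ≠ 0 := Finset.prod_ne_zero_iff.2 fun i _ => pow_ne_zero _ (inv_ne_zero hy0)
  rw [mul_left_comm, mul_right_inj' h]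
  constructor
  · intro h'
    rw [h', mul_inv_cancel_left₀ hy0]
  · intro h'
    rw [h', inv_mul_cancel_left₀ hy0]

/-! ### Comparison of chromatic radii -/

theorem SeparatingRadius.inv_le_chromaticRadius {k : ℕ} {R : ℝ} (h : SeparatingRadius k R) :
    R⁻¹ ≤ chromaticRadius (thetaGraph fun _ : Fin k => 2) := by
  obtain ⟨hR0, hR1, ⟨y, hy, hyR⟩, -⟩ := h
  have hy0 : y ≠ 0 := by
    rintro rfl
    simp at hy
  have hy1 : y ≠ 1 := by
    rintro rfl
    simp at hyR
    linarith
  have hroot := (aeval_chromaticPolynomial_thetaGraph_inv_eq_zero_iff (s := fun _ : Fin k => 2)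
    (fun _ => by norm_num) hy0 hy1).2 (by
      simp only [Finset.prod_const, Finset.card_univ, Fintype.card_fin]
      rw [show 1 - y ^ 2 = (1 - y ^ (2 - 1)) * (1 + y) by ring, mul_pow, hy, mul_comm])
  refine le_trans ?_ ((chromaticRadius_isGreatest _).2 ⟨_, hroot, rfl⟩)
  rw [sub_sub_cancel_left, norm_neg, norm_inv]
  exact inv_anti₀ (norm_pos_iff.2 hy0) hyR

theorem SeparatingRadius.chromaticRadius_lt_inv {k : ℕ} {R : ℝ} (h : SeparatingRadius k R)
    {s : Fin k → ℕ} (hs : ∀ i, 1 ≤ s i) (hne : ∃ i, s i ≠ 2) :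
    chromaticRadius (thetaGraph s) < R⁻¹ := by
  obtain ⟨hR0, hR1, -, h⟩ := h
  obtain ⟨z, hz, hρ⟩ := (chromaticRadius_isGreatest (thetaGraph s)).1
  rw [hρ]
  by_contra! hle
  have hpos : 0 < ‖z - 1‖ := (inv_pos.2 hR0).trans_le hle
  have hz1 : 1 - z ≠ 0 := by
    rw [← neg_sub, neg_ne_zero]
    exact norm_pos_iff.1 hpos
  have hyR : ‖(1 - z)⁻¹‖ ≤ R := by
    rw [norm_inv, norm_sub_rev]
    exact inv_le_of_inv_le₀ hR0 hle
  obtain ⟨y, hy⟩ : ∃ y, y = (1 - z)⁻¹ := ⟨_, rfl⟩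
  have hzy : z = 1 - y⁻¹ := by rw [hy, inv_inv]; ring
  have hy0 : y ≠ 0 := hy ▸ inv_ne_zero hz1
  rw [← hy] at hyR
  have hpow : ∀ t, t ≠ 0 → y ^ t ≠ 1 := by
    intro t ht h1
    have h2 := congrArg norm h1
    rw [norm_pow, norm_one] at h2
    exact absurd h2 (pow_lt_one₀ (norm_nonneg _) (hyR.trans_lt hR1) ht).ne
  rw [hzy, aeval_chromaticPolynomial_thetaGraph_inv_eq_zero_iff hs hy0
    (by simpa using hpow 1 one_ne_zero)] at hz
  by_cases h1 : ∃ i, s i = 1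
  -- A path of length 1 makes the right-hand product vanish, so some `y ^ s j = 1`, impossible for
  -- `‖y‖ < 1`.
  · obtain ⟨i, hi⟩ := h1
    rw [Finset.prod_eq_zero (f := fun i => 1 - y ^ (s i - 1)) (Finset.mem_univ i) (by simp [hi]),
      mul_zero, Finset.prod_eq_zero_iff] at hz
    obtain ⟨j, -, hj⟩ := hz
    exact hpow (s j) (by have := hs j; omega) (sub_eq_zero.1 hj).symm
  · push Not at h1
    exact h s (fun i => by have := hs i; have := h1 i; omega) hne y hyR hz

theorem mainTheorem4 (k : ℕ) (hk3 : 3 ≤ k) (hk8 : k ≤ 8) :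
    Nonempty (thetaGraph (fun _ : Fin k => 2) ≃g completeBipartiteGraph (Fin 2) (Fin k)) ∧
    ∀ s : Fin k → ℕ, (∀ i, 1 ≤ s i) →
      chromaticRadius (thetaGraph s) ≤ chromaticRadius (thetaGraph fun _ : Fin k => 2) ∧
      (chromaticRadius (thetaGraph s) = chromaticRadius (thetaGraph fun _ : Fin k => 2) ↔
        ∀ i, s i = 2) := by
  refine ⟨nonempty_thetaGraph_two_iso k, fun s hs => ?_⟩
  obtain ⟨R, hR⟩ := exists_separatingRadius hk3 hk8
  by_cases h : ∀ i, s i = 2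
  · obtain rfl : s = fun _ => 2 := funext h
    simp
  · have hlt := (hR.chromaticRadius_lt_inv hs (not_forall.1 h)).trans_le hR.inv_le_chromaticRadius
    exact ⟨hlt.le, iff_of_false hlt.ne h⟩
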